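/- Fix variables $x_1,x_2,\ldots$; a \emph{literal} is a variable $x$ or its formal inverse $x^{-1}$, with $\overline{x}=x^{-1}$ and $\overline{x^{-1}}=x$. A \emph{sequent} $\Gamma=\ell_1,\ldots,\ell_n$ ($n\ge 0$) is a finite sequence of literals; its inverse is $\overline{\Gamma}=\overline{\ell_n},\ldots,\overline{\ell_1}$, and $\Gamma,\Delta$ denotes concatenation. A \emph{hypersequent} $\mathcal G=\Gamma_1\mid\cdots\mid\Gamma_m$ is a finite set of sequents; $\mathcal G\mid\Gamma$ denotes $\mathcal G\cup\{\Gamma\}$. A sequent is identified with the group term $\ell_1\cdots\ell_n$ ($e$ if $n=0$), and it is \emph{group valid} if $\Gamma\approx e$ holds in all groups. An \emph{$\ell$-group} is a (not necessarily abelian) group with a lattice order such that $a\le b$ implies $cad\le cbd$. A non-empty hypersequent $\Gamma_1\mid\cdots\mid\Gamma_m$ is \emph{valid in all $\ell$-groups} if $e\le\Gamma_1\vee\cdots\vee\Gamma_m$ holds in every $\ell$-group under every assignment of the variables; the empty hypersequent is, by convention, not valid. For all hypersequents $\mathcal G$ and sequents $\Gamma,\Delta,\Sigma$, the calculus $\mathrm{GLG}$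 has the rules (gv) infer $\mathcal G\mid\Gamma$ from no premises, if $\Gamma$ is group valid; (em) infer $\mathcal G\mid\Delta\mid\overline{\Delta}$ from no premises; (cut) infer $\mathcal G\mid\Gamma,\Sigma$ from $\mathcal G\mid\Gamma,\Delta$ and $\mathcal G\mid\overline{\Delta},\Sigma$. The calculus $\mathrm{GLG}^*$ has the rules (gv); (split) infer $\mathcal G\mid\Gamma\mid\Delta$ from $\mathcal G\mid\Gamma,\Delta$; $(*)$ infer $\mathcal G$ from $\mathcal G\mid\Delta$ and $\mathcal G\mid\overline{\Delta}$, if $\Delta$ is not group valid. A hypersequent is \emph{derivable} in a calculus if it is the root of a finite tree of hypersequents each of whose nodes follows from its premises by a rule of the calculus. \textbf{Corollary.} For every hypersequent $\mathcal G$ the following are equivalent: (1) $\mathcal G$ is valid in all $\ell$-groups; (2) $\mathcal G$ is derivable in $\mathrm{GLG}$; (3) $\mathcal G$ is derivable in $\mathrm{GLG}^*$. -/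

import Mathlib

universe u v

namespace LGroupCalculi

/-- A literal over the variables `x₀, x₁, …`: the pair `(i, true)` stands for the variable `xᵢ`
and the pair `(i, false)` for its inverse `xᵢ⁻¹`. -/
abbrev Literal : Type := ℕ × Bool

/-- A sequent is a finite sequence of literals; the comma of sequents is `++`. -/
abbrev Sequent : Type := List Literal

/-- The inverse of a sequent: reverse the sequence and invert every literal. -/
def Sequent.inv (Γ : Sequent) : Sequent :=
  (Γ.map fun l => (l.1, !l.2)).reverse

/-- A hypersequent is a finite set of sequents; `G ∣ Γ` is `insert Γ G`. -/
abbrev Hypersequent : Type := Finset Sequent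

/-- The value of a sequent, read as the product of its literals (`1` if it has none), under an
assignment `v` of the variables in a group. -/
def Sequent.eval {H : Type u} [Group H] (v : ℕ → H) (Γ : Sequent) : H :=
  (Γ.map fun l => cond l.2 (v l.1) (v l.1)⁻¹).prod

/-- A sequent `Γ` is group valid if `Γ ≈ e` holds in all groups. -/
def Sequent.GroupValid (Γ : Sequent) : Prop :=
  ∀ (H : Type u) [Group H] (v : ℕ → H), Γ.eval v = 1

/-- A hypersequent `Γ₁ ∣ … ∣ Γₙ` is valid in all ℓ-groups if it is non-empty and
`e ≤ Γ₁ ∨ … ∨ Γₙ` holds in every lattice-ordered group (not necessarily commutative) under every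
assignment. The empty hypersequent is not valid: it stands for the empty join, which lies below
everything. -/
def Hypersequent.Valid (G : Hypersequent) : Prop :=
  ∃ hG : G.Nonempty,
    ∀ (L : Type u) [Group L] [Lattice L] [MulLeftMono L] [MulRightMono L] (v : ℕ → L),
      1 ≤ G.sup' hG (fun Γ => Γ.eval v)

/-- Derivability in the calculus GLG. -/
inductive GLG : Hypersequent → Prop
  | gv (G : Hypersequent) (Γ : Sequent) (hΓ : Sequent.GroupValid.{u} Γ) :
      GLG (insert Γ G)
  | em (G : Hypersequent) (Δ : Sequent) :
      GLG (insert Δ (insert Δ.inv G))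
  | cut (G : Hypersequent) (Γ Δ Θ : Sequent)
      (h₁ : GLG (insert (Γ ++ Δ) G)) (h₂ : GLG (insert (Δ.inv ++ Θ) G)) :
      GLG (insert (Γ ++ Θ) G)

/-- Derivability in the calculus GLG*. -/
inductive GLGStar : Hypersequent → Prop
  | gv (G : Hypersequent) (Γ : Sequent) (hΓ : Sequent.GroupValid.{u} Γ) :
      GLGStar (insert Γ G)
  | split (G : Hypersequent) (Γ Δ : Sequent) (h : GLGStar (insert (Γ ++ Δ) G)) :
      GLGStar (insert Γ (insert Δ G))
  | star (G : Hypersequent) (Δ : Sequent) (hΔ : ¬ Sequent.GroupValid.{u} Δ)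
      (h₁ : GLGStar (insert Δ G)) (h₂ : GLGStar (insert Δ.inv G)) :
      GLGStar G

end LGroupCalculi

/-! The pivot is a fourth condition: every left order on the free group makes some sequent of `G`
nonnegative. Validity implies it, since the free group acts on itself, so ordered, by translations,
and joins of automorphisms of a chain are pointwise. GLG* derivations preserve it. Conversely, the
complement of a maximal GLG-underivable set gives a total cone avoiding `G`, which shrinks to a left
order (`IsTotalCone.exists_antisymm_subset`), so the condition yields GLG derivability. The circle
is closed by soundness of cut (`one_le_sup_mul`) and its simulation in GLG* (`GLGStar.mul`). -/

open FreeGroup (mk)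

/-! ### An inequality in lattice-ordered groups -/

section LatticeOrderedGroup

variable {L : Type*} [Group L] [Lattice L] [MulLeftMono L] [MulRightMono L]

/-- Split `x` and `y` into positive part times negative part; both positive parts lie below `x ⊔ y`,
which then cancels. -/
theorem one_le_inf_one_sup_inf_one {x y : L} (h : 1 ≤ x ⊔ y) : 1 ≤ (x ⊓ 1) ⊔ (y ⊓ 1) := by
  have key : ∀ a : L, a = (1 ⊔ a) * (a ⊓ 1) := fun a => by
    rw [← mul_inv_eq_iff_eq_mul, inv_inf, mul_sup, mul_inv_cancel, inv_one, mul_one]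
  have hx : x ≤ (x ⊔ y) * ((x ⊓ 1) ⊔ (y ⊓ 1)) :=
    (key x).le.trans (mul_le_mul' (sup_le h le_sup_left) le_sup_left)
  have hy : y ≤ (x ⊔ y) * ((x ⊓ 1) ⊔ (y ⊓ 1)) :=
    (key y).le.trans (mul_le_mul' (sup_le h le_sup_right) le_sup_right)
  exact (le_mul_iff_one_le_right' _).1 (sup_le hx hy)

theorem inf_mul_le_one {p q r : L} (hp : 1 ≤ p) (hq : 1 ≤ q) (hr : 1 ≤ r)
    (hpq : p ⊓ q ≤ 1) (hpr : p ⊓ r ≤ 1) : p ⊓ q * r ≤ 1 := by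
  have h : p ⊓ q * r ≤ (p ⊓ q) * (p ⊓ r) := by
    rw [inf_mul, mul_inf, mul_inf]
    exact le_inf (inf_le_left.trans (le_inf (le_mul_of_one_le_left' hp) (le_mul_of_one_le_right' hr)))
      (le_inf (inf_le_left.trans (le_mul_of_one_le_left' hq)) inf_le_right)
  exact h.trans (mul_le_one' hpq hpr)

/-- Inverting negative parts turns the hypotheses into disjointness of positive elements, which
passes to products. This is the soundness of cut. -/
theorem one_le_sup_mul {x y z : L} (hy : 1 ≤ x ⊔ y) (hz : 1 ≤ x ⊔ z) : 1 ≤ x ⊔ y * z := by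
  have aux : ∀ a : L, 1 ≤ (a ⊓ 1)⁻¹ := fun a => one_le_inv'.2 inf_le_right
  have dis : ∀ a : L, 1 ≤ x ⊔ a → (x ⊓ 1)⁻¹ ⊓ (a ⊓ 1)⁻¹ ≤ 1 := fun a ha => by
    rw [← inv_sup, inv_le_one']
    exact one_le_inf_one_sup_inf_one ha
  have h := inf_mul_le_one (aux x) (aux z) (aux y) (dis z hz) (dis y hy)
  rw [← mul_inv_rev, ← inv_sup, inv_le_one'] at h
  exact h.trans (sup_le_sup inf_le_left (mul_le_mul' inf_le_left inf_le_left))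

end LatticeOrderedGroup

/-! ### The lattice-ordered group of automorphisms of a chain -/

section ChainAutomorphisms

variable {X : Type*} [LinearOrder X]

theorem OrderIso.surjective_sup (f g : X ≃o X) : Function.Surjective fun x => f x ⊔ g x := by
  intro y
  rcases le_total (f.symm y) (g.symm y) with h | h
  · exact ⟨f.symm y, by simpa using g.le_symm_apply.1 h⟩
  · exact ⟨g.symm y, by simpa using f.le_symm_apply.1 h⟩

theorem OrderIso.surjective_inf (f g : X ≃o X) : Function.Surjective fun x => f x ⊓ g x := by
  intro y
  rcases le_total (f.symm y) (g.symm y) with h | h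
  · exact ⟨g.symm y, by simpa using f.symm_apply_le.1 h⟩
  · exact ⟨f.symm y, by simpa using g.symm_apply_le.1 h⟩

/-- The pointwise lattice structure on the automorphisms of a chain. -/
@[reducible]
noncomputable def OrderIso.latticeOfChain : Lattice (X ≃o X) where
  __ := PartialOrder.lift (fun f : X ≃o X => (f : X → X)) DFunLike.coe_injective
  sup f g := StrictMono.orderIsoOfSurjective (fun x => f x ⊔ g x)
    (fun _ _ h => max_lt_max (f.strictMono h) (g.strictMono h)) (f.surjective_sup g)
  inf f g := StrictMono.orderIsoOfSurjective (fun x => f x ⊓ g x)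
    (fun _ _ h => min_lt_min (f.strictMono h) (g.strictMono h)) (f.surjective_inf g)
  le_sup_left _ _ _ := le_sup_left
  le_sup_right _ _ _ := le_sup_right
  sup_le _ _ _ h₁ h₂ x := sup_le (h₁ x) (h₂ x)
  inf_le_left _ _ _ := inf_le_left
  inf_le_right _ _ _ := inf_le_right
  le_inf _ _ _ h₁ h₂ x := le_inf (h₁ x) (h₂ x)

end ChainAutomorphisms

/-! ### Automorphisms of the real line with prescribed values at integers -/

section PiecewiseLinear

/-- Interpolate linearly between integers; bounded displacement gives surjectivity. -/
theorem exists_orderIso_of_strictMono_int (s : ℤ → ℝ) (hs : StrictMono s)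
    (hd : ∀ k, |s k - k| ≤ 1) : ∃ f : ℝ ≃o ℝ, ∀ k : ℤ, f k = s k := by
  have hstep : ∀ k, 0 < s (k + 1) - s k := fun k => sub_pos.2 (hs (lt_add_one k))
  set F : ℝ → ℝ := fun x => s ⌊x⌋ + Int.fract x * (s (⌊x⌋ + 1) - s ⌊x⌋) with hF
  have hmono : StrictMono F := by
    intro x y hxy
    rcases (Int.floor_mono hxy.le).eq_or_lt with h | h
    · have : Int.fract x < Int.fract y := by
        simp only [Int.fract, h]; linarith
      simp only [hF, h]
      have := mul_lt_mul_of_pos_right this (hstep ⌊y⌋)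
      linarith
    · have h₁ : F x < s (⌊x⌋ + 1) := by
        have := mul_lt_mul_of_pos_right (Int.fract_lt_one x) (hstep ⌊x⌋)
        simp only [hF]; linarith
      have h₂ : s ⌊y⌋ ≤ F y :=
        le_add_of_nonneg_right (mul_nonneg (Int.fract_nonneg y) (hstep _).le)
      exact h₁.trans_le ((hs.monotone (Int.add_one_le_of_lt h)).trans h₂)
  have hsurj : Function.Surjective F := by
    intro y
    obtain ⟨k, hk, hmax⟩ := Int.exists_greatest_of_bdd (P := fun k => s k ≤ y)
      ⟨⌈y⌉ + 1, fun z hz => by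
        have h₁ := (abs_le.1 (hd z)).1
        have h₂ := Int.le_ceil y
        have : (z : ℝ) ≤ (⌈y⌉ + 1 : ℤ) := by push_cast; linarith
        exact_mod_cast this⟩
      ⟨⌊y⌋ - 1, by
        have h₁ := (abs_le.1 (hd (⌊y⌋ - 1))).2
        have h₂ := Int.floor_le y
        push_cast at h₁
        linarith⟩
    have hk' : y < s (k + 1) := lt_of_not_ge fun h => by
      have := hmax (k + 1) h
      lia
    have ht₀ : 0 ≤ (y - s k) / (s (k + 1) - s k) := div_nonneg (by linarith) (hstep k).le
    have ht₁ : (y - s k) / (s (k + 1) - s k) < 1 := (div_lt_one (hstep k)).2 (by linarith)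
    have hfl : ⌊(k : ℝ) + (y - s k) / (s (k + 1) - s k)⌋ = k :=
      Int.floor_eq_iff.2 ⟨by linarith, by linarith⟩
    refine ⟨k + (y - s k) / (s (k + 1) - s k), ?_⟩
    simp only [hF, Int.fract, hfl, add_sub_cancel_left]
    rw [div_mul_cancel₀ _ (hstep k).ne']
    ring
  refine ⟨StrictMono.orderIsoOfSurjective F hmono hsurj, fun k => ?_⟩
  simp [hF]

theorem exists_orderIso_of_shifts (U D : Set ℤ) (h₀ : ∀ k ∈ U, k ∉ D) (h₁ : ∀ k ∈ U, k + 1 ∉ D)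
    (h₂ : ∀ k ∈ U, k + 2 ∉ D) :
    ∃ f : ℝ ≃o ℝ, (∀ k ∈ U, f (k : ℝ) = k + 1) ∧ ∀ k ∈ D, f (k : ℝ) = k - 1 := by
  classical
  -- A point of neither set moves by a third in the direction its neighbours force on it.
  set d : ℤ → ℝ := fun k => if k ∈ U then 1 else if k ∈ D then -1 else
    if k - 1 ∈ U then 1 / 3 else if k + 1 ∈ D then -1 / 3 else 0 with hd
  have hs : StrictMono fun k : ℤ => (k : ℝ) + d k := by
    refine strictMono_int_of_lt_succ fun k => ?_
    have e₀ := h₀ k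
    have e₁ := h₁ k
    have e₂ := h₁ (k - 1)
    have e₃ := h₂ (k - 1)
    rw [show k - 1 + 1 = k by ring] at e₂
    rw [show k - 1 + 2 = k + 1 by ring] at e₃
    simp only [hd]
    push_cast
    rw [show k + 1 - 1 = k by ring]
    split_ifs <;> first | linarith | (exfalso; tauto)
  obtain ⟨f, hf⟩ := exists_orderIso_of_strictMono_int _ hs fun k => by
    simp only [hd, add_sub_cancel_left]
    split_ifs <;> norm_num [abs_le]
  refine ⟨f, fun k hk => ?_, fun k hk => ?_⟩
  · rw [hf]; simp [hd, hk]
  · have : k ∉ U := fun h => h₀ k h hk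
    rw [hf]; simp [hd, hk, this, sub_eq_add_neg]

end PiecewiseLinear

namespace LGroupCalculi

/-! ### Total cones -/

/-- The cone of nonnegative elements of a total left-invariant preorder on a group. -/
structure IsTotalCone {F : Type*} [Group F] (P : Set F) : Prop where
  mul_mem : ∀ {a b}, a ∈ P → b ∈ P → a * b ∈ P
  total : ∀ a, a ∈ P ∨ a⁻¹ ∈ P

namespace IsTotalCone

variable {F : Type*} [Group F] {P : Set F}

theorem one_mem (hP : IsTotalCone P) : (1 : F) ∈ P := by
  simpa using hP.total 1

theorem inv_mem (hP : IsTotalCone P) {a : F} (h : a ∉ P) : a⁻¹ ∈ P :=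
  (hP.total a).resolve_left h

/-- Lexicographic refinement of a total cone by another one. -/
theorem refine_lex {Q : Set F} (hP : IsTotalCone P) (hQ : IsTotalCone Q) :
    IsTotalCone {a | a ∈ P ∧ (a⁻¹ ∈ P → a ∈ Q)} where
  mul_mem := by
    rintro a b ⟨ha, ha'⟩ ⟨hb, hb'⟩
    refine ⟨hP.mul_mem ha hb, fun h => ?_⟩
    have h₁ : a⁻¹ ∈ P := by simpa using hP.mul_mem hb h
    have h₂ : b⁻¹ ∈ P := by simpa using hP.mul_mem h ha
    exact hQ.mul_mem (ha' h₁) (hb' h₂)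
  total a := by
    have h₁ := hP.total a
    have h₂ := hQ.total a
    simp only [Set.mem_ofPred_eq, inv_inv]
    tauto

theorem sInter {c : Set (Set F)} (hc : ∀ P ∈ c, IsTotalCone P) (hch : IsChain (· ⊆ ·) c) :
    IsTotalCone (⋂₀ c) where
  mul_mem ha hb := fun P hP => (hc P hP).mul_mem (ha P hP) (hb P hP)
  total a := by
    by_contra! h
    simp only [Set.mem_sInter, not_forall] at h
    obtain ⟨⟨P, hP, haP⟩, Q, hQ, haQ⟩ := h
    rcases hch.total hP hQ with hPQ | hQP
    · exact haQ (hPQ ((hc P hP).inv_mem haP))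
    · exact haP (hQP (by simpa using (hc Q hQ).inv_mem haQ))

theorem of_action {X : Type*} [LinearOrder X] (φ : F →* (X ≃o X)) (x : X) :
    IsTotalCone {a | x ≤ φ a x} where
  mul_mem {a b} ha hb := by
    simp only [Set.mem_ofPred_eq] at ha hb
    rw [Set.mem_ofPred_eq, map_mul, RelIso.mul_apply]
    exact ha.trans ((φ a).monotone hb)
  total a := by
    refine (le_total x (φ a x)).imp id fun h => ?_
    simpa [← RelIso.mul_apply, ← map_mul] using (φ a⁻¹).monotone h

end IsTotalCone

/-! ### Orders on the free group -/

/-- The reduced word is read from the right as a path from its length `n` down to 0, each letter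
moving one step. Then `w` sends `n > 0` to 0, hence 0 below 0. -/
theorem exists_action_apply_zero_lt (w : FreeGroup ℕ) (hw : w ≠ 1) :
    ∃ φ : FreeGroup ℕ →* (ℝ ≃o ℝ), φ w 0 < 0 := by
  set L := w.toWord with hL
  have hred : ∀ (k : ℕ) (i : ℕ) (b : Bool), L[k]? = some (i, b) → L[k + 1]? ≠ some (i, !b) := by
    intro k i b h₁ h₂
    obtain ⟨hk₁, e₁⟩ := List.getElem?_eq_some_iff.1 h₁
    obtain ⟨hk₂, e₂⟩ := List.getElem?_eq_some_iff.1 h₂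
    have hchain : L.IsChain fun a b => a.1 = b.1 → a.2 = b.2 := FreeGroup.isReduced_toWord
    have := List.isChain_iff_getElem.1 hchain k hk₂
    simp [e₁, e₂] at this
  -- The letter at position `k` of the word has to map `k + 1` to `k`.
  have hf : ∀ i : ℕ, ∃ f : ℝ ≃o ℝ, (∀ k : ℕ, L[k]? = some (i, false) → f k = k + 1) ∧
      ∀ k : ℕ, L[k]? = some (i, true) → f (k + 1) = k := by
    intro i
    -- Same-point and distance-two conflicts would each be a cancelling pair of adjacent letters; a
    -- distance-one conflict would put two letters at one position.
    obtain ⟨f, hU, hD⟩ := exists_orderIso_of_shifts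
      {z | ∃ k : ℕ, z = k ∧ L[k]? = some (i, false)}
      {z | ∃ k : ℕ, z = k + 1 ∧ L[k]? = some (i, true)}
      (by
        rintro _ ⟨k, rfl, hk⟩ ⟨j, hj, hj'⟩
        obtain rfl : k = j + 1 := by lia
        exact hred j i true hj' hk)
      (by
        rintro _ ⟨k, rfl, hk⟩ ⟨j, hj, hj'⟩
        obtain rfl : k = j := by lia
        simp [hk] at hj')
      (by
        rintro _ ⟨k, rfl, hk⟩ ⟨j, hj, hj'⟩
        obtain rfl : j = k + 1 := by lia
        exact hred k i false hk hj')
    refine ⟨f, fun k hk => by simpa using hU k ⟨k, rfl, hk⟩, fun k hk => ?_⟩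
    simpa using hD (k + 1) ⟨k, rfl, hk⟩
  choose f hU hD using hf
  refine ⟨FreeGroup.lift f, ?_⟩
  have hpath : ∀ (M N : List (ℕ × Bool)), N ++ M = L →
      FreeGroup.lift f (mk M) (L.length : ℝ) = N.length := by
    intro M
    induction M with
    | nil =>
      intro N hN
      simp [← FreeGroup.one_eq_mk, ← hN]
    | cons l M ih =>
      intro N hN
      have hl : L[N.length]? = some l := by simp [← hN]
      have := ih (N ++ [l]) (by simpa using hN)
      rw [← List.singleton_append, ← FreeGroup.mul_mk, map_mul, RelIso.mul_apply, this]
      obtain ⟨i, _ | _⟩ := l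
      · have h := hU i _ hl
        simp only [FreeGroup.lift_mk, List.map_cons, List.map_nil, List.prod_singleton, cond_false]
        rw [List.length_append, List.length_singleton, Nat.cast_add, Nat.cast_one, ← h]
        exact (f i).symm_apply_apply _
      · simpa using hD i _ hl
  have hlen : (0 : ℝ) < L.length := by
    have : L ≠ [] := fun h => hw (FreeGroup.toWord_eq_nil_iff.1 h)
    exact_mod_cast List.length_pos_of_ne_nil this
  have h := hpath L [] rfl
  rw [hL, FreeGroup.mk_toWord, ← hL] at h
  simpa [h] using (FreeGroup.lift f w).strictMono hlen

/-- Take a minimal cone inside `P`. If it contained some `a ≠ 1` together with `a⁻¹`, refining it by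
an action that moves 0 down under `a` would remove `a`. -/
theorem IsTotalCone.exists_antisymm_subset {P : Set (FreeGroup ℕ)} (hP : IsTotalCone P) :
    ∃ Q ⊆ P, IsTotalCone Q ∧ ∀ a ∈ Q, a⁻¹ ∈ Q → a = 1 := by
  obtain ⟨Q, hQP, hQ⟩ := zorn_superset_nonempty {Q : Set (FreeGroup ℕ) | IsTotalCone Q}
    (fun c hc hch _ => ⟨⋂₀ c, IsTotalCone.sInter hc hch, fun _ => Set.sInter_subset_of_mem⟩) P hP
  refine ⟨Q, hQP, hQ.prop, fun a ha hinv => ?_⟩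
  by_contra hne
  obtain ⟨φ, hφ⟩ := exists_action_apply_zero_lt a hne
  have hle := hQ.le_of_le (IsTotalCone.refine_lex hQ.prop (IsTotalCone.of_action φ 0))
    (fun _ h => h.1)
  exact hφ.not_ge ((hle ha).2 hinv)

/-! ### Sequents as elements of the free group -/

theorem Sequent.eval_eq_lift {H : Type*} [Group H] (v : ℕ → H) (Γ : Sequent) :
    Γ.eval v = FreeGroup.lift v (mk Γ) := rfl

theorem Sequent.mk_inv (Γ : Sequent) : mk Γ.inv = (mk Γ)⁻¹ := rfl

theorem Sequent.mk_append (Γ Δ : Sequent) : mk (Γ ++ Δ) = mk Γ * mk Δ := rfl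

theorem Sequent.groupValid_iff (Γ : Sequent) : Sequent.GroupValid.{u} Γ ↔ mk Γ = 1 := by
  refine ⟨fun h => ?_, fun h H _ v => by rw [Sequent.eval_eq_lift, h, map_one]⟩
  let φ : FreeGroup ℕ →* ULift.{u} (FreeGroup ℕ) := MulEquiv.ulift.symm.toMonoidHom
  have h' := h (ULift.{u} (FreeGroup ℕ)) fun i => φ (FreeGroup.of i)
  have hφ : FreeGroup.lift (fun i => φ (FreeGroup.of i)) = φ := by
    ext i
    simp
  rw [Sequent.eval_eq_lift, hφ] at h'
  exact MulEquiv.ulift.symm.injective (h'.trans (map_one φ).symm)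

/-! ### Weakening -/

theorem GLG.weaken {G : Hypersequent} (h : GLG.{u} G) :
    ∀ {G' : Hypersequent}, G ⊆ G' → GLG.{u} G' := by
  induction h with
  | gv G Γ hΓ =>
    intro G' hG
    rw [← Finset.insert_eq_of_mem (hG (Finset.mem_insert_self Γ G))]
    exact .gv G' Γ hΓ
  | em G Δ =>
    intro G' hG
    rw [← Finset.insert_eq_of_mem (hG (Finset.mem_insert_self Δ _)),
      ← Finset.insert_eq_of_mem (a := Δ.inv) (s := G') (hG (by simp))]
    exact .em G' Δ
  | cut G Γ Δ Θ _ _ ih₁ ih₂ =>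
    intro G' hG
    have hsub := (Finset.subset_insert _ _).trans hG
    rw [← Finset.insert_eq_of_mem (hG (Finset.mem_insert_self (Γ ++ Θ) G))]
    exact .cut G' Γ Δ Θ (ih₁ (Finset.insert_subset_insert _ hsub))
      (ih₂ (Finset.insert_subset_insert _ hsub))

theorem GLGStar.weaken {G : Hypersequent} (h : GLGStar.{u} G) :
    ∀ {G' : Hypersequent}, G ⊆ G' → GLGStar.{u} G' := by
  induction h with
  | gv G Γ hΓ =>
    intro G' hG
    rw [← Finset.insert_eq_of_mem (hG (Finset.mem_insert_self Γ G))]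
    exact .gv G' Γ hΓ
  | split G Γ Δ _ ih =>
    intro G' hG
    rw [← Finset.insert_eq_of_mem (hG (Finset.mem_insert_self Γ _)),
      ← Finset.insert_eq_of_mem (a := Δ) (s := G') (hG (by simp))]
    exact .split G' Γ Δ (ih (Finset.insert_subset_insert _
      (((Finset.subset_insert _ _).trans (Finset.subset_insert _ _)).trans hG)))
  | star G Δ hΔ _ _ ih₁ ih₂ =>
    intro G' hG
    exact .star G' Δ hΔ (ih₁ (Finset.insert_subset_insert _ hG))
      (ih₂ (Finset.insert_subset_insert _ hG))

/-! ### GLG* simulates GLG -/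

theorem GLGStar.of_mk_mul_eq_one (G : Hypersequent) {Γ Δ : Sequent} (h : mk Γ * mk Δ = 1) :
    GLGStar.{u} (insert Γ (insert Δ G)) :=
  .split G Γ Δ (.gv G _ ((Sequent.groupValid_iff _).2 h))

/-- The rule `(*)` without its side condition, which the extra premise replaces. -/
theorem GLGStar.star_of_imp {G : Hypersequent} (Δ : Sequent) (h : mk Δ = 1 → GLGStar.{u} G)
    (h₁ : GLGStar.{u} (insert Δ G)) (h₂ : GLGStar.{u} (insert Δ.inv G)) : GLGStar.{u} G := by
  by_cases hΔ : mk Δ = 1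
  · exact h hΔ
  · exact .star G Δ (fun hv => hΔ ((Sequent.groupValid_iff Δ).1 hv)) h₁ h₂

/-- Branch with `(*)` on `Γ` and `Δ`. The premises close the branches adding `Γ` or `Δ`; with both
inverses present, split the group valid `Θ, Δ⁻¹, Γ⁻¹`. -/
theorem GLGStar.mul {G : Hypersequent} {Γ Δ Θ : Sequent} (h₁ : GLGStar.{u} (insert Γ G))
    (h₂ : GLGStar.{u} (insert Δ G)) (h : mk Θ = mk Γ * mk Δ) : GLGStar.{u} (insert Θ G) := by
  refine GLGStar.star_of_imp Γ (fun hΓ => ?_) (h₁.weaken (by grind)) ?_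
  · refine GLGStar.star_of_imp Δ (fun hΔ => .gv G Θ ?_) (h₂.weaken (by grind)) ?_
    · rw [Sequent.groupValid_iff, h, hΓ, hΔ, one_mul]
    · refine (GLGStar.of_mk_mul_eq_one G (Γ := Θ) (Δ := Δ.inv) ?_).weaken (by grind)
      rw [h, hΓ, Sequent.mk_inv, one_mul, mul_inv_cancel]
  · refine GLGStar.star_of_imp Δ (fun hΔ => ?_) (h₂.weaken (by grind)) ?_
    · refine (GLGStar.of_mk_mul_eq_one G (Γ := Θ) (Δ := Γ.inv) ?_).weaken (by grind)
      rw [h, hΔ, Sequent.mk_inv, mul_one, mul_inv_cancel]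
    · have := GLGStar.of_mk_mul_eq_one.{u} G (Γ := Θ) (Δ := Δ.inv ++ Γ.inv) (by
        rw [h, Sequent.mk_append, Sequent.mk_inv, Sequent.mk_inv]; group)
      rw [Finset.insert_comm] at this
      exact (GLGStar.split _ _ _ this).weaken (by grind)

theorem GLG.toGLGStar {G : Hypersequent} (h : GLG.{u} G) : GLGStar.{u} G := by
  induction h with
  | gv G Γ hΓ => exact .gv G Γ hΓ
  | em G Δ => exact GLGStar.of_mk_mul_eq_one G (by rw [Sequent.mk_inv, mul_inv_cancel])
  | cut G Γ Δ Θ _ _ ih₁ ih₂ =>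
    refine GLGStar.mul ih₁ ih₂ ?_
    simp only [Sequent.mk_append, Sequent.mk_inv]
    group

/-! ### Soundness -/

/-- A product of two negative elements is negative, which handles split. Only the identity is
nonnegative with its inverse, which is why `(*)` needs its side condition. -/
theorem GLGStar.exists_mem_cone {P : Set (FreeGroup ℕ)} (hP : IsTotalCone P)
    (hanti : ∀ a ∈ P, a⁻¹ ∈ P → a = 1) {G : Hypersequent} (h : GLGStar.{u} G) :
    ∃ Γ ∈ G, mk Γ ∈ P := by
  induction h with
  | gv G Γ hΓ =>
    exact ⟨Γ, Finset.mem_insert_self _ _, (Sequent.groupValid_iff Γ).1 hΓ ▸ hP.one_mem⟩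
  | split G Γ Δ _ ih =>
    obtain ⟨Θ, hΘ, hΘP⟩ := ih
    by_contra! hno
    rcases Finset.mem_insert.1 hΘ with rfl | hΘ
    · have hΓ : mk Γ ∉ P := hno Γ (by simp)
      have hΔ : mk Δ ∉ P := hno Δ (by simp)
      have h₁ : mk Γ * mk Δ = 1 := hanti _ hΘP (by
        rw [mul_inv_rev]
        exact hP.mul_mem (hP.inv_mem hΔ) (hP.inv_mem hΓ))
      exact hΓ (eq_inv_of_mul_eq_one_left h₁ ▸ hP.inv_mem hΔ)
    · exact hno Θ (by simp [hΘ]) hΘP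
  | star G Δ hΔ _ _ ih₁ ih₂ =>
    obtain ⟨Θ₁, h₁, hP₁⟩ := ih₁
    obtain ⟨Θ₂, h₂, hP₂⟩ := ih₂
    rcases Finset.mem_insert.1 h₁ with rfl | h₁
    · rcases Finset.mem_insert.1 h₂ with rfl | h₂
      · exact absurd ((Sequent.groupValid_iff _).2 (hanti _ hP₁ hP₂)) hΔ
      · exact ⟨Θ₂, h₂, hP₂⟩
    · exact ⟨Θ₁, h₁, hP₁⟩

/-- Quantifying over upper bounds `b` replaces the join, so the context `G` of a rule may be empty.
-/
theorem GLG.one_le_of_forall_eval_le {L : Type*} [Group L] [Lattice L] [MulLeftMono L]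
    [MulRightMono L] (v : ℕ → L) {G : Hypersequent} (h : GLG.{u} G) :
    ∀ b : L, (∀ Γ ∈ G, Γ.eval v ≤ b) → 1 ≤ b := by
  induction h with
  | gv G Γ hΓ =>
    intro b hb
    have := hb Γ (Finset.mem_insert_self _ _)
    rwa [Sequent.eval_eq_lift, (Sequent.groupValid_iff Γ).1 hΓ, map_one] at this
  | em G Δ =>
    intro b hb
    have h₁ := hb Δ (by simp)
    have h₂ := hb Δ.inv (by simp)
    rw [Sequent.eval_eq_lift, Sequent.mk_inv, map_inv, ← Sequent.eval_eq_lift] at h₂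
    exact (one_le_mabs (Δ.eval v)).trans (sup_le h₁ h₂)
  | cut G Γ Δ Θ _ _ ih₁ ih₂ =>
    intro b hb
    have hG : ∀ Ξ ∈ G, Ξ.eval v ≤ b := fun Ξ hΞ => hb Ξ (Finset.mem_insert_of_mem hΞ)
    have aux : ∀ Λ : Sequent, ∀ Ξ ∈ insert Λ G, Ξ.eval v ≤ b ⊔ Λ.eval v := by
      intro Λ Ξ hΞ
      rcases Finset.mem_insert.1 hΞ with rfl | hΞ
      · exact le_sup_right
      · exact (hG Ξ hΞ).trans le_sup_left
    have h := one_le_sup_mul (ih₁ _ (aux _)) (ih₂ _ (aux _))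
    have he : (Γ ++ Δ).eval v * (Δ.inv ++ Θ).eval v = (Γ ++ Θ).eval v := by
      simp only [Sequent.eval_eq_lift, Sequent.mk_append, Sequent.mk_inv, map_mul, map_inv]
      group
    rwa [he, sup_eq_left.2 (hb _ (Finset.mem_insert_self _ _))] at h

theorem GLG.valid {G : Hypersequent} (h : GLG.{u} G) : Hypersequent.Valid.{v} G := by
  have hne : G.Nonempty := by cases h <;> exact Finset.insert_nonempty _ _
  exact ⟨hne, fun L _ _ _ _ v => h.one_le_of_forall_eval_le v _ fun Γ hΓ =>
    Finset.le_sup' (fun Γ : Sequent => Γ.eval v) hΓ⟩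

/-! ### Completeness -/

theorem Hypersequent.Valid.exists_le_action {G : Hypersequent} (hG : Hypersequent.Valid.{v} G)
    {X : Type v} [LinearOrder X] (φ : FreeGroup ℕ →* (X ≃o X)) (x : X) :
    ∃ Γ ∈ G, x ≤ φ (mk Γ) x := by
  obtain ⟨hne, hval⟩ := hG
  let _ : Lattice (X ≃o X) := OrderIso.latticeOfChain
  have : MulLeftMono (X ≃o X) := ⟨fun f _ _ h x => f.monotone (h x)⟩
  have : MulRightMono (X ≃o X) := ⟨fun f _ _ h x => h (f x)⟩
  by_contra! hlt
  have h := hval (X ≃o X) fun i => φ (FreeGroup.of i)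
  have hφ : FreeGroup.lift (fun i => φ (FreeGroup.of i)) = φ := by
    ext i : 1
    simp
  have hsup : (G.sup' hne fun Γ => Γ.eval fun i => φ (FreeGroup.of i)) x < x :=
    Finset.sup'_induction (p := fun f : X ≃o X => f x < x) hne _ (fun _ h₁ _ h₂ => max_lt h₁ h₂)
      fun Γ hΓ => by
        rw [Sequent.eval_eq_lift, hφ]
        exact hlt Γ hΓ
  exact hsup.not_ge (h x)

/-- The chain of group elements ordered by a total antisymmetric cone. -/
@[reducible]
noncomputable def IsTotalCone.linearOrder {F : Type*} [Group F] {P : Set F} (hP : IsTotalCone P)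
    (hanti : ∀ a ∈ P, a⁻¹ ∈ P → a = 1) : LinearOrder F where
  le a b := a⁻¹ * b ∈ P
  le_refl a := by simpa using hP.one_mem
  le_trans a b c h₁ h₂ := by simpa [mul_assoc] using hP.mul_mem h₁ h₂
  le_antisymm a b h₁ h₂ := (inv_mul_eq_one.1 (hanti _ h₁ (by simpa using h₂)))
  le_total a b := by simpa using hP.total (a⁻¹ * b)
  toDecidableLE := Classical.decRel _

theorem Hypersequent.Valid.exists_mem_cone {G : Hypersequent} (hG : Hypersequent.Valid.{v} G)
    {P : Set (FreeGroup ℕ)} (hP : IsTotalCone P) (hanti : ∀ a ∈ P, a⁻¹ ∈ P → a = 1) :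
    ∃ Γ ∈ G, mk Γ ∈ P := by
  let _ : LinearOrder (FreeGroup ℕ) := hP.linearOrder hanti
  have hmono : ∀ a b c : FreeGroup ℕ, a * b ≤ a * c ↔ b ≤ c := fun a b c => by
    change (a * b)⁻¹ * (a * c) ∈ P ↔ b⁻¹ * c ∈ P
    simp [mul_assoc]
  let φ : FreeGroup ℕ →* (ULift.{v} (FreeGroup ℕ) ≃o ULift.{v} (FreeGroup ℕ)) :=
    { toFun := fun a =>
        { toFun := fun x => ⟨a * x.down⟩
          invFun := fun x => ⟨a⁻¹ * x.down⟩
          left_inv := fun x => by simp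
          right_inv := fun x => by simp
          map_rel_iff' := hmono a _ _ }
      map_one' := by ext x; simp
      map_mul' := fun a b => by ext x; simp [mul_assoc] }
  -- The orbit of the identity recovers the order: `1 ≤ a · 1` says that `a` lies in the cone.
  obtain ⟨Γ, hΓ, h⟩ := hG.exists_le_action φ ⟨1⟩
  refine ⟨Γ, hΓ, ?_⟩
  have h' : (1 : FreeGroup ℕ)⁻¹ * (mk Γ * 1) ∈ P := h
  simpa using h'

/-- Zorn applies because hypersequents are finite: one contained in the union of a chain lies in a
single member. -/
theorem exists_maximal_underivable {D : Hypersequent → Prop}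
    (hD : ∀ {G G' : Hypersequent}, D G → G ⊆ G' → D G') {G : Hypersequent} (hG : ¬ D G) :
    ∃ T : Set Sequent, ↑G ⊆ T ∧ (∀ G' : Hypersequent, ↑G' ⊆ T → ¬ D G') ∧
      ∀ Δ ∉ T, ∃ G' : Hypersequent, ↑G' ⊆ T ∧ D (insert Δ G') := by
  obtain ⟨T, hGT, hT⟩ := zorn_subset_nonempty
    {T : Set Sequent | ∀ G' : Hypersequent, ↑G' ⊆ T → ¬ D G'}
    (fun c hc hch hne => ⟨⋃₀ c, fun G' hG' hDG' => by
      obtain ⟨t, ht, htG⟩ := hch.directedOn.exists_mem_subset_of_finite_of_subset_sUnion hne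
        G'.finite_toSet hG'
      exact hc ht G' htG hDG', fun _ => Set.subset_sUnion_of_mem⟩) ↑G
    (fun G' hG' h => hG (hD h (Finset.coe_subset.1 hG')))
  refine ⟨T, hGT, hT.prop, fun Δ hΔ => ?_⟩
  by_contra! hno
  refine hΔ (hT.le_of_ge (y := insert Δ T) (fun G' hG' h => ?_) (Set.subset_insert _ _)
    (Set.mem_insert _ _))
  refine hno (G'.erase Δ) (fun Γ hΓ => ?_) (hD h (Finset.insert_erase_subset Δ G'))
  rw [Finset.mem_coe, Finset.mem_erase] at hΓ
  exact (hG' hΓ.2).resolve_left hΓ.1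

/-- The cone consists of the values of sequents outside a maximal underivable `T`. Cut on the empty
sequent gives products, (em) gives totality. -/
theorem GLG.exists_cone_of_not {G : Hypersequent} (hG : ¬ GLG.{u} G) :
    ∃ P : Set (FreeGroup ℕ), IsTotalCone P ∧ ∀ Γ ∈ G, mk Γ ∉ P := by
  obtain ⟨T, hGT, hT, hmax⟩ := exists_maximal_underivable (fun h hsub => GLG.weaken h hsub) hG
  have hnot : ∀ (G' : Hypersequent) (Γ : Sequent), ↑G' ⊆ T → GLG.{u} (insert Γ G') → Γ ∉ T :=
    fun G' Γ hG' h hΓ => hT _ (by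
      rw [Finset.coe_insert]
      exact Set.insert_subset hΓ hG') h
  refine ⟨{a | ∃ Γ ∉ T, mk Γ = a}, ⟨?_, fun a => ?_⟩, ?_⟩
  · rintro _ _ ⟨Γ, hΓ, rfl⟩ ⟨Δ, hΔ, rfl⟩
    obtain ⟨G₁, hG₁, h₁⟩ := hmax Γ hΓ
    obtain ⟨G₂, hG₂, h₂⟩ := hmax Δ hΔ
    refine ⟨Γ ++ Δ, hnot (G₁ ∪ G₂) _ (by simp [hG₁, hG₂]) ?_, rfl⟩
    refine GLG.cut _ Γ [] Δ ?_ ?_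
    · rw [List.append_nil]
      exact h₁.weaken (Finset.insert_subset_insert _ Finset.subset_union_left)
    · exact h₂.weaken (Finset.insert_subset_insert _ Finset.subset_union_right)
  · by_contra! h
    have hmem : ∀ Γ : Sequent, (mk Γ = a ∨ mk Γ = a⁻¹) → Γ ∈ T := fun Γ hΓ => by
      by_contra hΓT
      exact hΓ.elim (fun e => h.1 ⟨Γ, hΓT, e⟩) fun e => h.2 ⟨Γ, hΓT, e⟩
    have h₁ := hmem a.toWord (.inl FreeGroup.mk_toWord)
    have h₂ := hmem (Sequent.inv a.toWord) (.inr (by rw [Sequent.mk_inv, FreeGroup.mk_toWord]))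
    refine hT _ ?_ (GLG.em ∅ a.toWord)
    simp [Set.insert_subset_iff, h₁, h₂]
  -- Membership in `T` depends only on the group element: cut `Δ` against the group valid `Δ⁻¹, Γ`.
  · rintro Γ hΓ ⟨Δ, hΔ, he⟩
    obtain ⟨G', hG', h⟩ := hmax Δ hΔ
    refine hnot G' Γ hG' ?_ (hGT hΓ)
    refine GLG.cut G' [] Δ Γ h (.gv _ _ ((Sequent.groupValid_iff _).2 ?_))
    rw [Sequent.mk_append, Sequent.mk_inv, he, inv_mul_cancel]

theorem GLG.of_forall_cone {G : Hypersequent} (h : ∀ P : Set (FreeGroup ℕ), IsTotalCone P →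
    (∀ a ∈ P, a⁻¹ ∈ P → a = 1) → ∃ Γ ∈ G, mk Γ ∈ P) : GLG.{u} G := by
  by_contra hG
  obtain ⟨P, hP, hPG⟩ := GLG.exists_cone_of_not hG
  obtain ⟨Q, hQP, hQ, hanti⟩ := hP.exists_antisymm_subset
  obtain ⟨Γ, hΓ, hΓQ⟩ := h Q hQ hanti
  exact hPG Γ hΓ (hQP hΓQ)

end LGroupCalculi

/-- Soundness and completeness of GLG and GLG* for ℓ-groups. The universe `v` of the ℓ-groups and
the universe `u` of the groups in the side conditions of the rules are arbitrary. -/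
theorem mainTheorem5 (G : LGroupCalculi.Hypersequent) :
    List.TFAE
      [LGroupCalculi.Hypersequent.Valid.{v} G,
        LGroupCalculi.GLG.{u} G,
        LGroupCalculi.GLGStar.{u} G] := by
  tfae_have 1 → 2 := fun h => .of_forall_cone fun _ hP hanti => h.exists_mem_cone hP hanti
  tfae_have 2 → 1 := fun h => h.valid
  tfae_have 2 → 3 := fun h => h.toGLGStar
  tfae_have 3 → 2 := fun h => .of_forall_cone fun _ hP hanti => h.exists_mem_cone hP hanti
  tfae_finish
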